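/- Let $n,m,k,r\ge 0$ be integers, let $\Omega\subset\mathbb R^n$ and $U\subset\mathbb R^m$ be open, and let $g:\Omega\to U$ and $f:U\to\mathbb R^k$ be Lipschitz continuous. If $\operatorname{rank} Df\le r$ almost everywhere in $U$ (with respect to Lebesgue measure), then at almost every point of $\Omega$ the composition $f\circ g$ is differentiable and $\operatorname{rank} D(f\circ g)\le r$. (By Rademacher's theorem $f$ is differentiable almost everywhere in $U$; no assumption is made on how $g$ meets the set of points where $f$ is not differentiable.) -/

import Mathlib

open MeasureTheory Set

/-! The chain rule fails at points that `g` sends into the bad null set of `f`, so the rank bound is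
proved at every point where `f ∘ g` is differentiable; Rademacher's theorem supplies these almost
everywhere. Suppose the derivative there has rank `d > r`. Restricting to a `d`-dimensional slice
and projecting onto the range gives a map with derivative the identity, and its rescalings on the
unit ball are uniformly close to the identity with a fixed Lipschitz constant.

By Fubini, replacing `g` by `g + v` for almost every small `v` avoids the bad set almost everywhere
(`ae_ae_add_of_ae`). The chain rule then makes the `d`-dimensional Jacobian vanish almost
everywhere, while the map stays close to the identity. This contradicts
`exists_pos_not_ae_det_fderiv_eq_zero`, a degree argument: a Lipschitz map equal to the identity off
the ball has Jacobian integral equal to the ball's volume. -/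

/-! ### Jacobian integrals of Lipschitz maps that are the identity off the unit ball. -/

section Degree

variable {E : Type*} [NormedAddCommGroup E] [NormedSpace ℝ E]

theorem exists_pos_det_one_add_pos :
    ∃ η > 0, ∀ A : E →L[ℝ] E, ‖A‖ < η → 0 < (1 + A).det := by
  have hc : Continuous fun A : E →L[ℝ] E => (1 + A).det :=
    ContinuousLinearMap.continuous_det.comp (continuous_const.add continuous_id)
  have h : ∀ᶠ A : E →L[ℝ] E in nhds 0, 0 < (1 + A).det := by
    refine hc.continuousAt.eventually (lt_mem_nhds ?_)
    simp [ContinuousLinearMap.det, ContinuousLinearMap.one_def]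
  obtain ⟨η, hη, h⟩ := Metric.eventually_nhds_iff.1 h
  exact ⟨η, hη, fun A hA => h (by simpa using hA)⟩

variable [FiniteDimensional ℝ E]

/-- Along the line `1 + t • A`, the determinant at `t = 1` is a fixed affine combination of its
values at any `finrank ℝ E + 1` distinct nodes. -/
theorem exists_weights_det_one_add (s : Finset ℝ) (hs : Module.finrank ℝ E < s.card) :
    ∃ w : ℝ → ℝ, ∑ t ∈ s, w t = 1 ∧
      ∀ A : E →L[ℝ] E, (1 + A).det = ∑ t ∈ s, w t * (1 + t • A).det := by
  have hinj : Set.InjOn (id : ℝ → ℝ) s := Function.injective_id.injOn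
  have hne : s.Nonempty := Finset.card_pos.1 (by omega)
  refine ⟨fun t => (Lagrange.basis s id t).eval 1, ?_, fun A => ?_⟩
  · rw [← Polynomial.eval_finsetSum, Lagrange.sum_basis hinj hne, Polynomial.eval_one]
  · let b := Module.finBasis ℝ E
    let M := LinearMap.toMatrix b b (A : E →ₗ[ℝ] E)
    let p : Polynomial ℝ := Matrix.det
      ((Polynomial.X : Polynomial ℝ) • M.map Polynomial.C + (1 : Matrix _ _ ℝ).map Polynomial.C)
    have hp : ∀ t : ℝ, p.eval t = (1 + t • A).det := by
      intro t
      have h1 : p.eval t = (t • M + 1).det := by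
        simp only [p]
        rw [← Polynomial.coe_evalRingHom, RingHom.map_det]
        congr 1
        ext i j
        by_cases hij : i = j
        · simp [hij, mul_comm (M _ _)]
        · simp [hij, mul_comm (M _ _)]
      rw [h1, ContinuousLinearMap.det, ← LinearMap.det_toMatrix b]
      congr 1
      simp only [M, ContinuousLinearMap.toLinearMap_add, ContinuousLinearMap.toLinearMap_smul,
        map_add, map_smul]
      rw [add_comm]
      congr 1
      exact (LinearMap.toMatrix_one b).symm
    have hdeg : p.degree < s.card := by
      refine lt_of_le_of_lt Polynomial.degree_le_natDegree ?_
      have := Polynomial.natDegree_det_X_add_C_le M 1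
      rw [Fintype.card_fin] at this
      exact_mod_cast lt_of_le_of_lt this hs
    have := congrArg (Polynomial.eval 1) (Lagrange.eq_interpolate hinj hdeg)
    rw [hp 1, one_smul] at this
    rw [this, Lagrange.interpolate_apply, Polynomial.eval_finsetSum]
    refine Finset.sum_congr rfl fun t _ => ?_
    rw [Polynomial.eval_mul, Polynomial.eval_C, mul_comm, id, hp]

/-- Compare volumes: `A` sends the unit ball into the ball of radius `‖A‖`. -/
theorem ContinuousLinearMap.abs_det_le_norm_pow (A : E →L[ℝ] E) :
    |A.det| ≤ ‖A‖ ^ Module.finrank ℝ E := by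
  borelize E
  have h1 := (Measure.addHaar : Measure E).addHaar_image_continuousLinearMap A
    (Metric.closedBall 0 1)
  have h2 : A '' Metric.closedBall 0 1 ⊆ Metric.closedBall 0 ‖A‖ := by
    rintro _ ⟨x, hx, rfl⟩
    rw [mem_closedBall_zero_iff] at hx ⊢
    exact A.unit_le_opNorm x hx
  have h3 := measure_mono (μ := (Measure.addHaar : Measure E)) h2
  rw [h1, Measure.addHaar_closedBall' _ _ (norm_nonneg A)] at h3
  have h0 : (Measure.addHaar : Measure E) (Metric.closedBall 0 1) ≠ 0 :=
    (Metric.measure_closedBall_pos _ _ one_pos).ne'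
  have ht : (Measure.addHaar : Measure E) (Metric.closedBall 0 1) ≠ ⊤ :=
    measure_closedBall_lt_top.ne
  exact (ENNReal.ofReal_le_ofReal_iff (by positivity)).1 ((ENNReal.mul_le_mul_iff_left h0 ht).1 h3)

/-- A small Lipschitz perturbation of the identity, supported in the ball, permutes the ball. -/
theorem LipschitzWith.bijOn_ball_id_add {c : NNReal} (hc : c < 1) {e : E → E}
    (he : LipschitzWith c e) (h0 : ∀ x, x ∉ Metric.ball (0 : E) 1 → e x = 0) :
    BijOn (fun x => x + e x) (Metric.ball 0 1) (Metric.ball 0 1) := by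
  have hinj : Function.Injective fun x => x + e x := by
    intro x y hxy
    have h1 : x - y = e y - e x := by
      have : x + e x = y + e y := hxy
      rw [sub_eq_sub_iff_add_eq_add, this, add_comm]
    have h2 := he.norm_sub_le y x
    rw [← h1, norm_sub_rev y x] at h2
    by_contra hne
    have h3 : 0 < ‖x - y‖ := norm_pos_iff.2 (sub_ne_zero.2 hne)
    have h4 : (c : ℝ) < 1 := by exact_mod_cast hc
    nlinarith
  have hsurj : Function.Surjective fun x => x + e x := by
    intro y
    have hcon : ContractingWith c fun x => y - e x := by
      -- A fixed point of `x ↦ y - e x` solves `x + e x = y`.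
      refine ⟨hc, LipschitzWith.of_dist_le_mul fun a b => ?_⟩
      rw [dist_sub_left]
      exact he.dist_le_mul a b
    exact ⟨ContractingWith.fixedPoint _ hcon,
      eq_sub_iff_add_eq.1 (hcon.fixedPoint_isFixedPt).symm⟩
  have hout : ∀ x, x ∉ Metric.ball (0 : E) 1 → x + e x = x := fun x hx => by
    rw [h0 x hx, add_zero]
  -- Points off the ball are fixed, so by injectivity no point of the ball can land outside it.
  refine ⟨fun x hx => ?_, hinj.injOn, fun y hy => ?_⟩
  · by_contra hx'
    exact hx' (by rwa [hinj (hout _ hx')])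
  · obtain ⟨x, hx⟩ := hsurj y
    refine ⟨x, ?_, hx⟩
    by_contra hx'
    exact hx' (by rwa [← show x + e x = x from hout x hx', show x + e x = y from hx])

variable [MeasurableSpace E] [BorelSpace E] (μ : Measure E)

theorem LipschitzWith.integrable_det_fderiv {C : NNReal} {h : E → E} (hh : LipschitzWith C h)
    {s : Set E} (hs : μ s ≠ ⊤) (t : ℝ) :
    IntegrableOn (fun x => (1 + t • fderiv ℝ h x).det) s μ := by
  have hm : Measurable fun x => (1 + t • fderiv ℝ h x).det :=
    ContinuousLinearMap.continuous_det.measurable.comp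
      (measurable_const.add ((measurable_fderiv ℝ h).const_smul t))
  refine Measure.integrableOn_of_bounded (M := (1 + |t| * C) ^ Module.finrank ℝ E) hs
    hm.aestronglyMeasurable (Filter.Eventually.of_forall fun x => ?_)
  rw [Real.norm_eq_abs]
  refine (ContinuousLinearMap.abs_det_le_norm_pow _).trans ?_
  gcongr
  refine (norm_add_le _ _).trans (add_le_add ContinuousLinearMap.norm_id_le ?_)
  rw [norm_smul, Real.norm_eq_abs]
  gcongr
  exact norm_fderiv_le_of_lipschitz ℝ hh

variable [μ.IsAddHaarMeasure]

theorem LipschitzWith.addHaar_image_eq_zero {C : NNReal} {h : E → E} (hh : LipschitzWith C h)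
    {s : Set E} (hs : μ s = 0) : μ (h '' s) = 0 := by
  have h1 : Measure.hausdorffMeasure (Module.finrank ℝ E : ℝ) s = 0 :=
    Measure.absolutelyContinuous_isAddHaarMeasure _ μ hs
  have h2 := hh.hausdorffMeasure_image_le (d := Module.finrank ℝ E) (Nat.cast_nonneg _) s
  rw [h1, mul_zero, nonpos_iff_eq_zero] at h2
  exact Measure.absolutelyContinuous_isAddHaarMeasure μ _ h2

/-- Change of variables on the differentiability points of the ball; the remaining points form a
null set, whose Lipschitz image is null. -/
theorem LipschitzWith.setIntegral_abs_det_id_add {c : NNReal} (hc : c < 1) {e : E → E}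
    (he : LipschitzWith c e) (h0 : ∀ x, x ∉ Metric.ball (0 : E) 1 → e x = 0) :
    ∫ x in Metric.ball 0 1, |(1 + fderiv ℝ e x).det| ∂μ = μ.real (Metric.ball 0 1) := by
  have hb := he.bijOn_ball_id_add hc h0
  set B : Set E := Metric.ball 0 1
  set D : Set E := {x | DifferentiableAt ℝ e x}
  have hD : MeasurableSet D := measurableSet_of_differentiableAt ℝ e
  have hBm : MeasurableSet B := measurableSet_ball
  have hDn : μ (B \ D) = 0 :=
    measure_mono_null (fun x hx => hx.2) (ae_iff.1 (he.ae_differentiableAt (μ := μ)))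
  have hae : (B ∩ D : Set E) =ᵐ[μ] B := by
    refine ae_eq_set.2 ⟨?_, by rwa [sdiff_self_inter]⟩
    rw [sdiff_eq_empty.2 inter_subset_left, measure_empty]
  have hlip : LipschitzWith (1 + c) fun x => x + e x := LipschitzWith.id.add he
  have himg : (fun x => x + e x) '' (B ∩ D) =ᵐ[μ] B := by
    refine ae_eq_set.2 ⟨?_, ?_⟩
    · rw [sdiff_eq_empty.2 ((image_mono inter_subset_left).trans hb.image_eq.subset)]
      exact measure_empty
    · refine measure_mono_null ?_ (hlip.addHaar_image_eq_zero μ hDn)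
      rintro y ⟨hy, hx'⟩
      obtain ⟨x, hx, rfl⟩ := hb.surjOn hy
      exact ⟨x, ⟨hx, fun hxD => hx' ⟨x, ⟨hx, hxD⟩, rfl⟩⟩, rfl⟩
  have key := integral_image_eq_integral_abs_det_fderiv_smul μ (hBm.inter hD)
    (f := fun x => x + e x) (f' := fun x => 1 + fderiv ℝ e x)
    (fun x hx => ((hasFDerivAt_id x).add hx.2.hasFDerivAt).hasFDerivWithinAt)
    (hb.injOn.mono inter_subset_left) (fun _ => (1 : ℝ))
  rw [setIntegral_congr_set himg, setIntegral_congr_set hae] at key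
  simpa using key.symm

/-- The integral of the Jacobian determinant of a Lipschitz map that is the identity off the unit
ball is the volume of the ball. -/
theorem LipschitzWith.setIntegral_det_id_add {C : NNReal} {e : E → E}
    (he : LipschitzWith C e) (h0 : ∀ x, x ∉ Metric.ball (0 : E) 1 → e x = 0) :
    ∫ x in Metric.ball 0 1, (1 + fderiv ℝ e x).det ∂μ = μ.real (Metric.ball 0 1) := by
  obtain ⟨η, hη, hdet⟩ := exists_pos_det_one_add_pos (E := E)
  -- For `0 < t < a`, the bound by `η` makes the Jacobian of `id + t • e` positive, and the bound by
  -- `1` makes the map a bijection of the ball. The integral is a polynomial in `t` of degree at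
  -- most `finrank ℝ E`, so its values at that many nodes plus one determine it at `t = 1`.
  obtain ⟨a, ha, haη, ha1⟩ : ∃ a : ℝ, 0 < a ∧ a * C < η ∧ a * C < 1 := by
    have hC : (0 : ℝ) ≤ C := C.2
    refine ⟨min η 1 / (C + 1), by positivity, ?_, ?_⟩ <;>
    · rw [div_mul_eq_mul_div, div_lt_iff₀ (by positivity)]
      have h1 : min η 1 * C ≤ min η 1 * C := le_rfl
      have h2 := min_le_left η 1
      have h3 := min_le_right η 1
      have h4 : 0 < min η 1 := by positivity
      nlinarith
  obtain ⟨s, hsa, hs⟩ := (Set.Ioo_infinite ha).exists_subset_card_eq (Module.finrank ℝ E + 1)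
  obtain ⟨w, hw1, hw⟩ := exists_weights_det_one_add (E := E) s (by omega)
  have hsmall : ∀ t ∈ s,
      ∫ x in Metric.ball 0 1, (1 + t • fderiv ℝ e x).det ∂μ = μ.real (Metric.ball 0 1) := by
    intro t ht
    obtain ⟨ht0, hta⟩ := hsa ht
    have hC : (0 : ℝ) ≤ C := C.2
    have htC : t * C ≤ a * C := by gcongr
    have hte : LipschitzWith (t.toNNReal * C) fun x => t • e x := by
      refine LipschitzWith.of_dist_le_mul fun x y => ?_
      rw [dist_smul₀, Real.norm_of_nonneg ht0.le, NNReal.coe_mul, Real.coe_toNNReal _ ht0.le, mul_assoc]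
      gcongr
      exact he.dist_le_mul x y
    have hc1 : t.toNNReal * C < 1 := by
      rw [← NNReal.coe_lt_coe, NNReal.coe_mul, Real.coe_toNNReal _ ht0.le]
      exact htC.trans_lt ha1
    rw [← hte.setIntegral_abs_det_id_add μ hc1 fun x hx => by rw [h0 x hx, smul_zero]]
    refine integral_congr_ae (Filter.Eventually.of_forall fun x => ?_)
    have hfd : fderiv ℝ (fun x => t • e x) x = t • fderiv ℝ e x :=
      congrFun (fderiv_const_smul_field t) x
    simp only [hfd]
    refine (abs_of_pos (hdet _ ?_)).symm
    rw [norm_smul, Real.norm_of_nonneg ht0.le]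
    refine lt_of_le_of_lt ?_ haη
    refine le_trans ?_ htC
    gcongr
    exact norm_fderiv_le_of_lipschitz ℝ he
  rw [integral_congr_ae (Filter.Eventually.of_forall fun x => hw (fderiv ℝ e x)), integral_finsetSum]
  · simp_rw [integral_const_mul]
    rw [Finset.sum_congr rfl fun t ht => by rw [hsmall t ht], ← Finset.sum_mul, hw1, one_mul]
  · exact fun t _ => (he.integrable_det_fderiv μ measure_ball_lt_top.ne t).const_mul _

end Degree

/-! ### Cutting off a map close to the identity. -/

section Cutoff

variable {E : Type*} [NormedAddCommGroup E]

/-- A cutoff equal to `1` on the ball of radius `1 - τ` and to `0` off the unit ball. -/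
noncomputable def ballCutoff (τ : ℝ) (x : E) : ℝ := max 0 (min 1 ((1 - ‖x‖) / τ))

theorem ballCutoff_nonneg (τ : ℝ) (x : E) : 0 ≤ ballCutoff τ x := le_max_left _ _

theorem ballCutoff_le_one (τ : ℝ) (x : E) : ballCutoff τ x ≤ 1 :=
  max_le zero_le_one (min_le_left _ _)

theorem ballCutoff_eq_zero {τ : ℝ} (hτ : 0 < τ) {x : E} (hx : 1 ≤ ‖x‖) : ballCutoff τ x = 0 :=
  max_eq_left ((min_le_right _ _).trans (div_nonpos_of_nonpos_of_nonneg (by linarith) hτ.le))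

theorem ballCutoff_eq_one {τ : ℝ} (hτ : 0 < τ) {x : E} (hx : ‖x‖ ≤ 1 - τ) :
    ballCutoff τ x = 1 := by
  rw [ballCutoff, min_eq_left, max_eq_right zero_le_one]
  rw [le_div_iff₀ hτ]
  linarith

theorem ballCutoff_mul_le {τ : ℝ} (hτ : 0 < τ) {x : E} (hx : ‖x‖ ≤ 1) :
    ballCutoff τ x * τ ≤ 1 - ‖x‖ := by
  rw [← le_div_iff₀ hτ]
  exact max_le (div_nonneg (by linarith) hτ.le) (min_le_right _ _)

theorem abs_ballCutoff_sub_mul_le {τ : ℝ} (hτ : 0 < τ) (x y : E) :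
    |ballCutoff τ x - ballCutoff τ y| * τ ≤ ‖x - y‖ := by
  have h1 : |ballCutoff τ x - ballCutoff τ y| ≤ |(1 - ‖x‖) / τ - (1 - ‖y‖) / τ| := by
    refine (abs_max_sub_max_le_max _ _ _ _).trans ?_
    rw [sub_self, abs_zero]
    refine max_le (abs_nonneg _) ((abs_min_sub_min_le_max _ _ _ _).trans ?_)
    rw [sub_self, abs_zero]
    exact max_le (abs_nonneg _) le_rfl
  rw [← sub_div, abs_div, abs_of_pos hτ, le_div_iff₀ hτ] at h1
  refine h1.trans ?_
  rw [show 1 - ‖x‖ - (1 - ‖y‖) = ‖y‖ - ‖x‖ by ring, norm_sub_rev]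
  exact abs_norm_sub_norm_le y x

variable [NormedSpace ℝ E]

/-- The constant does not depend on `τ`: the cutoff has slope `1 / τ`, but it multiplies a
displacement of size at most `τ`. -/
theorem LipschitzOnWith.ballCutoff_smul_sub {L : NNReal} {K : E → E} {τ : ℝ} (hτ : 0 < τ)
    (hK : LipschitzOnWith L K (Metric.closedBall 0 1))
    (hKτ : ∀ x ∈ Metric.closedBall (0 : E) 1, ‖K x - x‖ ≤ τ) :
    LipschitzWith (L + 2) fun x => ballCutoff τ x • (K x - x) := by
  have hL : (0 : ℝ) ≤ L := L.2
  have hmixed : ∀ x y : E, ‖x‖ ≤ 1 → 1 < ‖y‖ →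
      ‖ballCutoff τ x • (K x - x) - ballCutoff τ y • (K y - y)‖ ≤ (L + 2) * ‖x - y‖ := by
    intro x y hx hy
    rw [ballCutoff_eq_zero hτ hy.le, zero_smul, sub_zero, norm_smul,
      Real.norm_of_nonneg (ballCutoff_nonneg _ _)]
    calc ballCutoff τ x * ‖K x - x‖ ≤ ballCutoff τ x * τ := by
          gcongr
          · exact ballCutoff_nonneg _ _
          · exact hKτ x (by simpa using hx)
      _ ≤ 1 - ‖x‖ := ballCutoff_mul_le hτ hx
      _ ≤ ‖y‖ - ‖x‖ := by linarith
      _ ≤ ‖x - y‖ := by rw [norm_sub_rev]; exact norm_sub_norm_le y x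
      _ ≤ (L + 2) * ‖x - y‖ := le_mul_of_one_le_left (norm_nonneg _) (by linarith)
  refine LipschitzWith.of_dist_le_mul fun x y => ?_
  rw [dist_eq_norm, dist_eq_norm, NNReal.coe_add, NNReal.coe_ofNat]
  rcases le_or_gt ‖x‖ 1 with hx | hx <;> rcases le_or_gt ‖y‖ 1 with hy | hy
  · have hx' : x ∈ Metric.closedBall (0 : E) 1 := by simpa using hx
    have hy' : y ∈ Metric.closedBall (0 : E) 1 := by simpa using hy
    have h1 : ‖K x - K y‖ ≤ L * ‖x - y‖ := hK.norm_sub_le hx' hy'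
    have hsplit : ballCutoff τ x • (K x - x) - ballCutoff τ y • (K y - y) =
        (ballCutoff τ x - ballCutoff τ y) • (K x - x) +
          ballCutoff τ y • ((K x - K y) - (x - y)) := by module
    rw [hsplit]
    refine (norm_add_le _ _).trans ?_
    rw [norm_smul, norm_smul, Real.norm_eq_abs, Real.norm_of_nonneg (ballCutoff_nonneg _ _)]
    have h2 : |ballCutoff τ x - ballCutoff τ y| * ‖K x - x‖ ≤ ‖x - y‖ :=
      (mul_le_mul_of_nonneg_left (hKτ x hx') (abs_nonneg _)).trans
        (abs_ballCutoff_sub_mul_le hτ x y)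
    have h3 : ballCutoff τ y * ‖(K x - K y) - (x - y)‖ ≤ 1 * (L * ‖x - y‖ + ‖x - y‖) :=
      mul_le_mul (ballCutoff_le_one _ _) ((_root_.norm_sub_le _ _).trans (by linarith))
        (norm_nonneg _) zero_le_one
    linarith
  · exact hmixed x y hx hy
  · rw [norm_sub_rev, norm_sub_rev x y]
    exact hmixed y x hy hx
  · rw [ballCutoff_eq_zero hτ hx.le, ballCutoff_eq_zero hτ hy.le, zero_smul, zero_smul, sub_self,
      norm_zero]
    positivity

variable [FiniteDimensional ℝ E] [MeasurableSpace E] [BorelSpace E] (μ : Measure E)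
  [μ.IsAddHaarMeasure]

/-- A Lipschitz map of the unit ball that is uniformly close to the identity, in terms of its
Lipschitz constant, cannot have vanishing Jacobian determinant almost everywhere. -/
theorem exists_pos_not_ae_det_fderiv_eq_zero (L : NNReal) :
    ∃ τ > 0, ∀ K : E → E, LipschitzOnWith L K (Metric.closedBall 0 1) →
      (∀ x ∈ Metric.closedBall (0 : E) 1, ‖K x - x‖ ≤ τ) →
      ¬ ∀ᵐ x ∂μ.restrict (Metric.ball 0 1), (fderiv ℝ K x).det = 0 := by
  set d := Module.finrank ℝ E
  -- `L + 3` bounds the norm of `1 + fderiv ℝ e x`, and `1 - (1 - τ) ^ d` is the volume fraction of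
  -- the shell where the cutoff is active. The shell alone thus cannot account for the volume of the
  -- ball.
  obtain ⟨τ, hτ0, hτ1, hτ⟩ :
      ∃ τ : ℝ, 0 < τ ∧ τ < 1 ∧ ((L : ℝ) + 3) ^ d * (1 - (1 - τ) ^ d) < 1 := by
    have hc : Continuous fun τ : ℝ => ((L : ℝ) + 3) ^ d * (1 - (1 - τ) ^ d) := by fun_prop
    have h : ∀ᶠ τ : ℝ in nhds 0, ((L : ℝ) + 3) ^ d * (1 - (1 - τ) ^ d) < 1 :=
      hc.continuousAt.eventually (gt_mem_nhds (by simp))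
    obtain ⟨ε, hε, h⟩ := Metric.eventually_nhds_iff.1 h
    have h4 : 0 < min ε 1 := by positivity
    refine ⟨min ε 1 / 2, by positivity, by linarith [min_le_right ε 1], h ?_⟩
    rw [dist_zero_right, Real.norm_of_nonneg (by positivity)]
    linarith [min_le_left ε 1]
  refine ⟨τ, hτ0, fun K hK hKτ hdet => ?_⟩
  have he := hK.ballCutoff_smul_sub hτ0 hKτ
  set e : E → E := fun x => ballCutoff τ x • (K x - x) with he_def
  set B : Set E := Metric.ball 0 1
  set b : Set E := Metric.ball 0 (1 - τ)
  have hbB : b ⊆ B := Metric.ball_subset_ball (by linarith)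
  have htot := he.setIntegral_det_id_add μ fun x hx => by
    rw [he_def]
    simp only
    rw [ballCutoff_eq_zero hτ0 (by simpa using hx), zero_smul]
  have hint : IntegrableOn (fun x => (1 + fderiv ℝ e x).det) B μ := by
    simpa using he.integrable_det_fderiv μ (s := B) measure_ball_lt_top.ne 1
  have hinner : ∫ x in b, (1 + fderiv ℝ e x).det ∂μ = 0 := by
    refine integral_eq_zero_of_ae ?_
    have hdet' := ae_restrict_of_ae_restrict_of_subset hbB hdet
    have hdiff : ∀ᵐ x ∂μ.restrict b, DifferentiableAt ℝ e x :=
      ae_restrict_of_ae he.ae_differentiableAt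
    filter_upwards [hdet', hdiff, ae_restrict_mem Metric.isOpen_ball.measurableSet]
      with x hx hxd hxb
    have hloc : K =ᶠ[nhds x] fun y => y + e y := by
      filter_upwards [Metric.isOpen_ball.mem_nhds hxb] with y hy
      rw [he_def]
      simp only
      rw [ballCutoff_eq_one hτ0 (by simpa using (mem_ball_zero_iff.1 hy).le), one_smul,
        add_sub_cancel]
    have hfd : HasFDerivAt (fun y => y + e y) (1 + fderiv ℝ e x) x :=
      (hasFDerivAt_id x).add hxd.hasFDerivAt
    rw [hloc.fderiv_eq, hfd.fderiv] at hx
    exact hx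
  have houter : ∫ x in B \ b, (1 + fderiv ℝ e x).det ∂μ ≤
      ((L : ℝ) + 3) ^ d * μ.real (B \ b) := by
    refine (le_abs_self _).trans ?_
    rw [← Real.norm_eq_abs]
    refine norm_setIntegral_le_of_norm_le_const
      ((measure_mono sdiff_subset).trans_lt measure_ball_lt_top) fun x _ => ?_
    rw [Real.norm_eq_abs]
    refine (ContinuousLinearMap.abs_det_le_norm_pow _).trans ?_
    gcongr
    refine (norm_add_le _ _).trans ?_
    have h1 := norm_fderiv_le_of_lipschitz ℝ he (x₀ := x)
    have h2 : ‖(1 : E →L[ℝ] E)‖ ≤ 1 := ContinuousLinearMap.norm_id_le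
    rw [NNReal.coe_add, NNReal.coe_ofNat] at h1
    linarith
  have hsplit := integral_inter_add_sdiff (s := B) (t := b) Metric.isOpen_ball.measurableSet hint
  rw [inter_eq_self_of_subset_right hbB, hinner, zero_add, htot] at hsplit
  have hvol : μ.real (B \ b) = (1 - (1 - τ) ^ d) * μ.real B := by
    rw [measureReal_sdiff hbB Metric.isOpen_ball.measurableSet]
    have : μ.real b = (1 - τ) ^ d * μ.real B := by
      rw [measureReal_def, Measure.addHaar_ball_of_pos _ _ (by linarith), ENNReal.toReal_mul,
        ENNReal.toReal_ofReal (pow_nonneg (by linarith) _)]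
      rfl
    rw [this]
    ring
  have hpos : 0 < μ.real B :=
    ENNReal.toReal_pos (Metric.measure_ball_pos μ _ one_pos).ne' measure_ball_lt_top.ne
  rw [hsplit, hvol] at houter
  nlinarith

end Cutoff

/-! ### Generic translations and the rank bound. -/

section Rank

theorem LinearMap.det_eq_zero_of_finrank_range_lt {E : Type*} [AddCommGroup E] [Module ℝ E]
    [FiniteDimensional ℝ E] (A : E →ₗ[ℝ] E)
    (h : Module.finrank ℝ (LinearMap.range A) < Module.finrank ℝ E) : LinearMap.det A = 0 := by
  by_contra hdet
  have hA : LinearMap.range A = ⊤ :=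
    LinearMap.range_eq_top.2 (LinearMap.equivOfDetNeZero A hdet).surjective
  rw [hA, finrank_top] at h
  exact lt_irrefl _ h

theorem ContinuousLinearMap.det_comp_eq_zero {E Y Z : Type*} [NormedAddCommGroup E]
    [NormedSpace ℝ E] [FiniteDimensional ℝ E] [NormedAddCommGroup Y] [NormedSpace ℝ Y]
    [NormedAddCommGroup Z] [NormedSpace ℝ Z] [FiniteDimensional ℝ Z]
    (P : Z →L[ℝ] E) (A : Y →L[ℝ] Z) (Q : E →L[ℝ] Y)
    (h : Module.finrank ℝ (LinearMap.range A.toLinearMap) < Module.finrank ℝ E) :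
    (P ∘L A ∘L Q).det = 0 := by
  refine LinearMap.det_eq_zero_of_finrank_range_lt _ (lt_of_le_of_lt ?_ h)
  have h1 : LinearMap.range (P ∘L A ∘L Q).toLinearMap ≤
      (LinearMap.range A.toLinearMap).map P.toLinearMap := by
    rintro _ ⟨x, rfl⟩
    exact ⟨A (Q x), ⟨Q x, rfl⟩, rfl⟩
  exact (Submodule.finrank_mono h1).trans (Submodule.finrank_map_le _ _)

/-- A property holding almost everywhere is seen almost everywhere by almost every translate of a
given map. -/
theorem ae_ae_add_of_ae {E Y : Type*} [MeasurableSpace E] [AddGroup Y] [MeasurableSpace Y]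
    [MeasurableAdd₂ Y] {μ : Measure E} [SFinite μ] {ν : Measure Y} [SFinite ν]
    [ν.IsAddLeftInvariant] {G : E → Y} (hG : AEMeasurable G μ) {p : Y → Prop}
    (hp : ∀ᵐ y ∂ν, p y) : ∀ᵐ v ∂ν, ∀ᵐ z ∂μ, p (G z + v) := by
  obtain ⟨s, hsub, hsm, hs⟩ := exists_measurable_superset_of_null (ae_iff.1 hp)
  have hmeas : MeasurableSet {q : Y × E | hG.mk G q.2 + q.1 ∉ s} :=
    (((hG.measurable_mk.comp measurable_snd).add measurable_fst) hsm).compl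
  -- For fixed `z`, the translation `v ↦ G z + v` preserves `ν`, so the bad `v` form a null set;
  -- Fubini exchanges the quantifiers.
  have h := (Measure.ae_ae_comm (μ := ν) (ν := μ) hmeas).2
    (Filter.Eventually.of_forall fun z =>
      (measurePreserving_add_left ν (hG.mk G z)).quasiMeasurePreserving.ae
        (measure_eq_zero_iff_ae_notMem.1 hs))
  filter_upwards [h] with v hv
  filter_upwards [hv, hG.ae_eq_mk] with z hz hGz
  rw [hGz]
  by_contra hpz
  exact hz (hsub hpz)

variable {X Y Z : Type*} [NormedAddCommGroup X] [NormedSpace ℝ X] [FiniteDimensional ℝ X]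
  [NormedAddCommGroup Y] [NormedSpace ℝ Y] [FiniteDimensional ℝ Y]
  [NormedAddCommGroup Z] [NormedSpace ℝ Z] [FiniteDimensional ℝ Z]
  [MeasurableSpace Y] [BorelSpace Y] (ν : Measure Y) [ν.IsAddHaarMeasure]

theorem LipschitzOnWith.ae_differentiableAt_of_isOpen {U : Set Y} (hU : IsOpen U) {L : NNReal}
    {f : Y → Z} (hf : LipschitzOnWith L f U) : ∀ᵐ y ∂ν.restrict U, DifferentiableAt ℝ f y := by
  filter_upwards [hf.ae_differentiableWithinAt (μ := ν) hU.measurableSet,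
    ae_restrict_mem hU.measurableSet] with y hy hyU
  exact hy.differentiableAt (hU.mem_nhds hyU)

/-- Almost every small translate `f ∘ (G + v)` of a Lipschitz composition has vanishing Jacobian
determinant after projection to a space of dimension exceeding the rank of `f`. -/
theorem ae_ae_det_fderiv_comp_eq_zero {E : Type*} [NormedAddCommGroup E] [NormedSpace ℝ E]
    [FiniteDimensional ℝ E] [MeasurableSpace E] [BorelSpace E] (μ : Measure E)
    [μ.IsAddHaarMeasure] {r : ℕ} (hr : r < Module.finrank ℝ E) {U : Set Y} (hU : IsOpen U)
    {L : NNReal} {f : Y → Z} (hf : LipschitzOnWith L f U)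
    (hrank : ∀ᵐ y ∂(ν.restrict U),
      Module.finrank ℝ (LinearMap.range (fderiv ℝ f y).toLinearMap) ≤ r)
    {V : Set E} (hV : IsOpen V) {M : NNReal} {G : E → Y} (hG : LipschitzOnWith M G V)
    (P : Z →L[ℝ] E) (c : Z) :
    ∀ᵐ v ∂ν, (∀ z ∈ V, G z + v ∈ U) →
      ∀ᵐ z ∂μ.restrict V, (fderiv ℝ (fun z => P (f (G z + v) - c)) z).det = 0 := by
  have hgood : ∀ᵐ y ∂ν, y ∈ U → DifferentiableAt ℝ f y ∧
      Module.finrank ℝ (LinearMap.range (fderiv ℝ f y).toLinearMap) ≤ r :=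
    (ae_restrict_iff' hU.measurableSet).1 ((hf.ae_differentiableAt_of_isOpen ν hU).and hrank)
  filter_upwards [ae_ae_add_of_ae (μ := μ.restrict V)
    (hG.continuousOn.aemeasurable hV.measurableSet) hgood] with v hv hvU
  filter_upwards [hv, hG.ae_differentiableAt_of_isOpen μ hV, ae_restrict_mem hV.measurableSet]
    with z hz hGz hzV
  obtain ⟨hfd, hfr⟩ := hz (hvU z hzV)
  have h1 : HasFDerivAt (fun z => P (f (G z + v) - c))
      (P ∘L fderiv ℝ f (G z + v) ∘L fderiv ℝ G z) z :=
    P.hasFDerivAt.comp z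
      ((hfd.hasFDerivAt.comp z (hGz.hasFDerivAt.add_const v)).sub_const c)
  rw [h1.fderiv]
  exact ContinuousLinearMap.det_comp_eq_zero _ _ _ (hfr.trans_lt hr)

/-- The contradiction is obtained by blowing up at `0` and translating `G` by a small generic `v`.
-/
theorem finrank_le_of_hasFDerivAt_id {E : Type*} [NormedAddCommGroup E] [NormedSpace ℝ E]
    [FiniteDimensional ℝ E] {r : ℕ} {U : Set Y} (hU : IsOpen U)
    {L : NNReal} {f : Y → Z} (hf : LipschitzOnWith L f U)
    (hrank : ∀ᵐ y ∂(ν.restrict U),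
      Module.finrank ℝ (LinearMap.range (fderiv ℝ f y).toLinearMap) ≤ r)
    {W : Set E} (hW : W ∈ nhds 0) {M : NNReal} {G : E → Y} (hG : LipschitzOnWith M G W)
    (hGU : G 0 ∈ U) (P : Z →L[ℝ] E)
    (hder : HasFDerivAt (fun z => P (f (G z))) (ContinuousLinearMap.id ℝ E) 0) :
    Module.finrank ℝ E ≤ r := by
  by_contra! hr
  borelize E
  let μ : Measure E := Measure.addHaar
  -- This Lipschitz constant serves every scale, since the factors `ρ⁻¹` and `ρ` cancel; hence `τ`
  -- can be fixed before `ρ`.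
  obtain ⟨τ, hτ, hcore⟩ := exists_pos_not_ae_det_fderiv_eq_zero μ (‖P‖₊ * L * M)
  obtain ⟨δ, hδ, hδU⟩ := Metric.isOpen_iff.1 hU _ hGU
  have hGc : ContinuousAt G 0 := hG.continuousOn.continuousAt hW
  have hlin := hder.isLittleO.bound (half_pos hτ)
  have hclose : ∀ᶠ z in nhds (0 : E), dist (G z) (G 0) < δ / 2 :=
    Metric.tendsto_nhds.1 hGc _ (half_pos hδ)
  obtain ⟨ρ, hρ, hball⟩ :=
    Metric.nhds_basis_closedBall.eventually_iff.1 ((hlin.and hclose).and hW)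
  have hscale : ∀ z ∈ Metric.closedBall (0 : E) 1, ρ • z ∈ Metric.closedBall (0 : E) ρ := by
    intro z hz
    rw [mem_closedBall_zero_iff] at hz ⊢
    rw [norm_smul, Real.norm_of_nonneg hρ.le]
    exact mul_le_of_le_one_right hρ.le hz
  have hGρ : LipschitzOnWith (M * ρ.toNNReal) (fun z => G (ρ • z)) (Metric.closedBall 0 1) := by
    refine LipschitzOnWith.of_dist_le_mul fun x hx y hy => ?_
    have := hG.dist_le_mul _ (hball (hscale x hx)).2 _ (hball (hscale y hy)).2
    rwa [dist_smul₀, Real.norm_of_nonneg hρ.le, ← mul_assoc, ← Real.coe_toNNReal ρ hρ.le,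
      ← NNReal.coe_mul, Real.coe_toNNReal ρ hρ.le] at this
  have hae := ae_ae_det_fderiv_comp_eq_zero ν μ hr hU hf hrank Metric.isOpen_ball
    (hGρ.mono Metric.ball_subset_closedBall) (ρ⁻¹ • P) (f (G 0))
  -- The first bound keeps the translate inside `U`; the second lets the translation move the
  -- rescaled map by at most `τ / 2`, the other half of `τ` being the linearization error.
  set ε : ℝ := min (δ / 2) (ρ * τ / (2 * (‖P‖ * L + 1)))
  have hL : (0 : ℝ) ≤ L := L.2
  have hε0 : 0 < ε := by positivity
  obtain ⟨v, hvε, hv⟩ : ∃ v, v ∈ Metric.ball (0 : Y) ε ∧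
      ((∀ z ∈ Metric.ball (0 : E) 1, G (ρ • z) + v ∈ U) →
      ∀ᵐ z ∂μ.restrict (Metric.ball 0 1),
        (fderiv ℝ (fun z => (ρ⁻¹ • P) (f (G (ρ • z) + v) - f (G 0))) z).det = 0) := by
    have hne : ν (Metric.ball 0 ε) ≠ 0 := (Metric.measure_ball_pos ν _ hε0).ne'
    obtain ⟨v, hv1, hv2⟩ :=
      ((frequently_ae_mem_iff.2 hne).and_eventually hae).exists
    exact ⟨v, hv1, hv2⟩
  rw [mem_ball_zero_iff] at hvε
  have hmem : ∀ z ∈ Metric.closedBall (0 : E) 1, G (ρ • z) + v ∈ U := by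
    intro z hz
    refine hδU ?_
    have h1 := (hball (hscale z hz)).1.2
    have h2 : ‖v‖ < δ / 2 := hvε.trans_le (min_le_left _ _)
    rw [Metric.mem_ball, dist_eq_norm]
    rw [dist_eq_norm] at h1
    calc ‖G (ρ • z) + v - G 0‖ = ‖(G (ρ • z) - G 0) + v‖ := by congr 1; abel
      _ ≤ ‖G (ρ • z) - G 0‖ + ‖v‖ := norm_add_le _ _
      _ < δ := by linarith
  have hmem' : ∀ z ∈ Metric.closedBall (0 : E) 1, G (ρ • z) ∈ U := by
    intro z hz
    exact hδU (Metric.ball_subset_ball (half_le_self hδ.le) (hball (hscale z hz)).1.2)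
  refine hcore (fun z => (ρ⁻¹ • P) (f (G (ρ • z) + v) - f (G 0))) ?_ ?_
    (hv fun z hz => hmem z (Metric.ball_subset_closedBall hz))
  · refine LipschitzOnWith.of_dist_le_mul fun x hx y hy => ?_
    have h1 := hf.norm_sub_le (hmem x hx) (hmem y hy)
    have h2 := hGρ.norm_sub_le hx hy
    rw [add_sub_add_right_eq_sub] at h1
    rw [NNReal.coe_mul, Real.coe_toNNReal ρ hρ.le] at h2
    rw [dist_eq_norm, ← map_sub, sub_sub_sub_cancel_right, dist_eq_norm]
    calc ‖(ρ⁻¹ • P) (f (G (ρ • x) + v) - f (G (ρ • y) + v))‖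
        ≤ ‖ρ⁻¹ • P‖ * (L * (M * ρ * ‖x - y‖)) :=
          (ContinuousLinearMap.le_opNorm _ _).trans (by gcongr; exact h1.trans (by gcongr))
      _ = (‖P‖₊ * L * M : NNReal) * ‖x - y‖ := by
          rw [norm_smul, norm_inv, Real.norm_of_nonneg hρ.le]
          push_cast
          field_simp
  · intro z hz
    have h1 := (hball (hscale z hz)).1.1
    simp only [ContinuousLinearMap.id_apply, sub_zero] at h1
    have h2 : ‖f (G (ρ • z) + v) - f (G (ρ • z))‖ ≤ L * ‖v‖ := by
      simpa using hf.norm_sub_le (hmem z hz) (hmem' z hz)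
    have h3 : ‖ρ • z‖ ≤ ρ := by simpa using hscale z hz
    have h4 : ‖P‖ * (L * ‖v‖) ≤ ρ * (τ / 2) := by
      have h5 : ‖v‖ * (2 * (‖P‖ * L + 1)) ≤ ρ * τ :=
        (le_div_iff₀ (by positivity)).1 (hvε.le.trans (min_le_right _ _))
      nlinarith [norm_nonneg v]
    have hsplit : (ρ⁻¹ • P) (f (G (ρ • z) + v) - f (G 0)) - z =
        ρ⁻¹ • (P (f (G (ρ • z) + v) - f (G (ρ • z))) +
          (P (f (G (ρ • z))) - P (f (G 0)) - ρ • z)) := by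
      rw [smul_add, smul_sub _ _ (ρ • z), inv_smul_smul₀ hρ.ne']
      simp only [smul_apply, map_sub, smul_sub]
      abel
    rw [hsplit, norm_smul, norm_inv, Real.norm_of_nonneg hρ.le, inv_mul_le_iff₀ hρ]
    calc _ ≤ ‖P‖ * (L * ‖v‖) + τ / 2 * ‖ρ • z‖ :=
          (norm_add_le _ _).trans (add_le_add
            ((ContinuousLinearMap.le_opNorm _ _).trans (by gcongr)) h1)
      _ ≤ ρ * (τ / 2) + τ / 2 * ρ := by gcongr
      _ = ρ * τ := by ring

/-- If `Df` has rank at most `r` almost everywhere, then so does `D(f ∘ g)` at every point where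
`f ∘ g` is differentiable. -/
theorem finrank_range_le_of_hasFDerivAt_comp {r : ℕ} {Ω : Set X} {U : Set Y} (hΩ : IsOpen Ω)
    (hU : IsOpen U) {g : X → Y} {f : Y → Z} (hgU : MapsTo g Ω U) {K L : NNReal}
    (hg : LipschitzOnWith K g Ω) (hf : LipschitzOnWith L f U)
    (hrank : ∀ᵐ y ∂(ν.restrict U),
      Module.finrank ℝ (LinearMap.range (fderiv ℝ f y).toLinearMap) ≤ r)
    {x : X} (hx : x ∈ Ω) {D : X →L[ℝ] Z} (hD : HasFDerivAt (f ∘ g) D x) :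
    Module.finrank ℝ (LinearMap.range D.toLinearMap) ≤ r := by
  -- A section `i` of `D` over its range and a projection `P` onto that range turn `D` into the
  -- identity of a space whose dimension is the rank.
  obtain ⟨i, hi⟩ := D.toLinearMap.rangeRestrict.exists_rightInverse_of_surjective
    (LinearMap.range_rangeRestrict _)
  obtain ⟨P, hP⟩ := (LinearMap.range D.toLinearMap).subtype.exists_leftInverse_of_injective
    (Submodule.ker_subtype _)
  let i' : LinearMap.range D.toLinearMap →L[ℝ] X := LinearMap.toContinuousLinearMap i
  let P' : Z →L[ℝ] LinearMap.range D.toLinearMap := LinearMap.toContinuousLinearMap P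
  have hid : P' ∘L D ∘L i' = ContinuousLinearMap.id ℝ _ := by
    ext1 z
    have h1 : D (i z) = z := congrArg Subtype.val (LinearMap.congr_fun hi z)
    change P (D (i z)) = z
    rw [h1]
    exact LinearMap.congr_fun hP z
  have haff : LipschitzWith ‖i'‖₊ fun z => x + i' z := by
    simpa using (LipschitzWith.const x).add i'.lipschitz
  have h0 : x + i' 0 = x := by rw [map_zero, add_zero]
  refine finrank_le_of_hasFDerivAt_id ν hU hf hrank (W := (fun z => x + i' z) ⁻¹' Ω)
    (haff.continuous.continuousAt.preimage_mem_nhds (by simpa using hΩ.mem_nhds hx))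
    (G := fun z => g (x + i' z)) (hg.comp haff.lipschitzOnWith fun z hz => hz)
    (by simpa using hgU hx) P' ?_
  rw [← hid]
  have h1 : HasFDerivAt (fun z => x + i' z) i' 0 := i'.hasFDerivAt.const_add x
  rw [← h0] at hD
  have h2 : HasFDerivAt (fun z => f (g (x + i' z))) (D ∘L i') 0 :=
    HasFDerivAt.comp (g := f ∘ g) (f := fun z => x + i' z) 0 hD h1
  exact P'.hasFDerivAt.comp (0 : LinearMap.range D.toLinearMap) h2

end Rank

theorem lemma3p4 (n m k r : ℕ)
    (Ω : Set (EuclideanSpace ℝ (Fin n))) (U : Set (EuclideanSpace ℝ (Fin m)))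
    (hΩ : IsOpen Ω) (hU : IsOpen U)
    (g : EuclideanSpace ℝ (Fin n) → EuclideanSpace ℝ (Fin m))
    (f : EuclideanSpace ℝ (Fin m) → EuclideanSpace ℝ (Fin k))
    (hgU : MapsTo g Ω U)
    (hg : ∃ K, LipschitzOnWith K g Ω) (hf : ∃ L, LipschitzOnWith L f U)
    (hrank : ∀ᵐ y ∂(volume.restrict U),
      Module.finrank ℝ (LinearMap.range (fderiv ℝ f y).toLinearMap) ≤ r) :
    ∀ᵐ x ∂(volume.restrict Ω),
      DifferentiableAt ℝ (f ∘ g) x ∧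
        Module.finrank ℝ (LinearMap.range (fderiv ℝ (f ∘ g) x).toLinearMap) ≤ r := by
  obtain ⟨K, hg⟩ := hg
  obtain ⟨L, hf⟩ := hf
  filter_upwards [(hf.comp hg hgU).ae_differentiableAt_of_isOpen volume hΩ,
    ae_restrict_mem hΩ.measurableSet] with x hx hxΩ
  exact ⟨hx, finrank_range_le_of_hasFDerivAt_comp volume hΩ hU hgU hg hf hrank hxΩ
    hx.hasFDerivAt⟩
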